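/- Let $H$ be a separable complex Hilbert space and let $L(H)$ be the algebra of bounded linear operators on $H$. Let $A_W$ be the Wiener algebra of functions $f(t)=\sum_{n\ge0}f_nt^n$ on $\overline{\mathbb D}=\{|t|\le1\}$ with $\sum_n|f_n|<\infty$. For $T\in L(H)$ with spectrum $\sigma(T)\subset\overline{\mathbb D}$, let $\mathcal A_{T,\mathbb R}$ (respectively $\mathcal A^0_{T,\mathbb R}$) be the set of all $f\in A_W$ with real Taylor coefficients $f_n$ for which the series $\sum_{n\ge0}|f_n|T^{*n}T^n$ converges in the strong operator topology (respectively in the operator norm). For a function $f(t)=\sum_{n\ge0}f_nt^n$ analytic in $\mathbb D=\{|t|<1\}$ put $f(T^*,T):=\sum_{n\ge0}f_nT^{*n}T^n$ whenever this series converges in the strong operator topology. For $a>0$, an operator $T\in L(H)$ is called an $a$-contraction if $f(T^*,T)$ exists and $f(T^*,T)\ge0$ for $f(t)=(1-t)^a$ (principal branch). **Corollary 1.2.** Let $\hat T\in L(H)$ with $\sigma(\hat T)\subset\overline{\mathbb D}$. Suppose that $\gamma(t)=(1-t)^a\,\tilde\gamma(t)$ in $\mathbb D$ for some $a>0$, where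 $(1-t)^a\in\mathcal A_{\hat T,\mathbb R}$, and $\tilde\gamma\in\mathcal A^0_{\hat T,\mathbb R}$ is positive on the interval $[0,1]$. (Then the series defining $\gamma(\hat T^*,\hat T)$ converges in the strong operator topology.) If $\gamma(\hat T^*,\hat T)\ge0$, then $\hat T$ is similar to an $a$-contraction $T\in L(H)$, that is, there is a bounded invertible operator $B$ on $H$ such that $B\hat TB^{-1}$ is an $a$-contraction. -/

import Mathlib

open Filter Topology

/-- The `n`-th Taylor coefficient at the origin of a function of a complex variable. -/
noncomputable def taylorCoeff (f : ℂ → ℂ) (n : ℕ) : ℂ :=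
  iteratedDeriv n f 0 / (n.factorial : ℂ)

/-- Membership in the Wiener algebra `A_W`: the Taylor coefficients are absolutely summable and
the Taylor series represents `f` on the closed unit disc. Values of `f` outside the closed unit
disc play no role. -/
structure MemWiener (f : ℂ → ℂ) : Prop where
  summable : Summable fun n => ‖taylorCoeff f n‖
  hasSum : ∀ t : ℂ, ‖t‖ ≤ 1 → HasSum (fun n => taylorCoeff f n * t ^ n) (f t)

/-- The Taylor coefficients of `f` are real. -/
def HasRealCoeffs (f : ℂ → ℂ) : Prop :=
  ∀ n, (taylorCoeff f n).im = 0

section Operators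

variable {H : Type*} [NormedAddCommGroup H] [InnerProductSpace ℂ H] [CompleteSpace H]

/-- The partial sum `∑_{n < N} c n • T*ⁿ Tⁿ`. -/
noncomputable def hereditaryPartialSum (c : ℕ → ℂ) (T : H →L[ℂ] H) (N : ℕ) : H →L[ℂ] H :=
  ∑ n ∈ Finset.range N, c n • ((ContinuousLinearMap.adjoint T) ^ n * T ^ n)

/-- The series `∑ c n • T*ⁿ Tⁿ` converges to `S` in the strong operator topology. -/
def ConvergesSOT (c : ℕ → ℂ) (T S : H →L[ℂ] H) : Prop :=
  ∀ x : H, Tendsto (fun N => hereditaryPartialSum c T N x) atTop (𝓝 (S x))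

/-- The series `∑ c n • T*ⁿ Tⁿ` converges to `S` in the operator norm. -/
def ConvergesNorm (c : ℕ → ℂ) (T S : H →L[ℂ] H) : Prop :=
  Tendsto (fun N => hereditaryPartialSum c T N) atTop (𝓝 S)

/-- `f ∈ 𝒜_T`: `f ∈ A_W` and `∑ |f_n| T*ⁿ Tⁿ` converges in the strong operator topology. -/
def MemA (T : H →L[ℂ] H) (f : ℂ → ℂ) : Prop :=
  MemWiener f ∧ ∃ S : H →L[ℂ] H, ConvergesSOT (fun n => (‖taylorCoeff f n‖ : ℂ)) T S

/-- `f ∈ 𝒜_T⁰`: `f ∈ A_W` and `∑ |f_n| T*ⁿ Tⁿ` converges in the operator norm. -/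
def MemA0 (T : H →L[ℂ] H) (f : ℂ → ℂ) : Prop :=
  MemWiener f ∧ ∃ S : H →L[ℂ] H, ConvergesNorm (fun n => (‖taylorCoeff f n‖ : ℂ)) T S

/-- `f ∈ 𝒜_{T,ℝ}`. -/
def MemAReal (T : H →L[ℂ] H) (f : ℂ → ℂ) : Prop :=
  MemA T f ∧ HasRealCoeffs f

/-- `f ∈ 𝒜⁰_{T,ℝ}`. -/
def MemA0Real (T : H →L[ℂ] H) (f : ℂ → ℂ) : Prop :=
  MemA0 T f ∧ HasRealCoeffs f

/-- The series defining `f(T*, T)` converges in the strong operator topology. -/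
def HereditaryConverges (f : ℂ → ℂ) (T : H →L[ℂ] H) : Prop :=
  ∃ S : H →L[ℂ] H, ConvergesSOT (taylorCoeff f) T S

open Classical in
/-- `f(T*, T) = ∑ f_n T*ⁿ Tⁿ`, the sum being taken in the strong operator topology
(the default value `0` is used if the series does not converge). -/
noncomputable def hereditary (f : ℂ → ℂ) (T : H →L[ℂ] H) : H →L[ℂ] H :=
  if h : HereditaryConverges f T then h.choose else 0

/-- The function `t ↦ (1 - t)ᵃ` (principal branch, which is analytic on the unit disc). -/
noncomputable def oneSubPow (a : ℝ) : ℂ → ℂ :=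
  fun t => (1 - t) ^ (a : ℂ)

/-- `T` is an `a`-contraction: `(1 - t)ᵃ(T*, T)` exists and is a nonnegative operator. -/
def IsAContraction (a : ℝ) (T : H →L[ℂ] H) : Prop :=
  HereditaryConverges (oneSubPow a) T ∧ (hereditary (oneSubPow a) T).IsPositive

/-- Similarity of operators: `T = B T' B⁻¹` for a bounded invertible operator `B`. -/
def IsSimilarOp (T' T : H →L[ℂ] H) : Prop :=
  ∃ B : H ≃L[ℂ] H,
    T = (B : H →L[ℂ] H) ∘L T' ∘L (B.symm : H →L[ℂ] H)

end Operators

/-!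
With `F` the Taylor series of `γ̃` and `A` that of the first factor of `γ`, replace the norm by the
equivalent Hilbert norm `‖B x‖² = ∑ₙ (g F)ₙ ‖Tⁿ x‖²`, for a power series `g` with nonnegative
coefficients which makes this form coercive. In the new norm the form of `A` is the form of
`A (g F) = g (A F)` in the old one, that is `∑ₖ gₖ ⟪γ(T*, T) Tᵏ x, Tᵏ x⟫ ≥ 0`.

To find `g`, truncate `F` and subtract a small constant: by norm convergence of `∑ |Fₙ| T*ⁿ Tⁿ`,
the form of `F` dominates that of a polynomial `p` still positive on `[0, 1]`, and hence on `[0, ρ]`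
for some `ρ > 1`. For large `K`, all coefficients of `g p` with `g = (1 - t / ρ)⁻ᴷ⁻¹` are
nonnegative: the `n`-th one is `ρ⁻ⁿ C(n + K, K)` times a quantity which tends to `p (ρ n / (n + K))`
uniformly in `n` as `K → ∞`. The form of `g` is bounded since `ρ > 1`, and the form of `g F`
dominates that of `g p`, hence `p(0) ‖x‖²`.
-/

open scoped PowerSeries Polynomial NNReal
open PowerSeries (coeff constantCoeff)

section Multiplier

lemma choose_mul_descFactorial_add (m j K : ℕ) :
    (m + K).choose K * (m + j + K).descFactorial j
      = (m + j + K).choose K * (m + j).descFactorial j := by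
  have hK : (m + K).factorial * (m + j + K).descFactorial j = (m + j + K).factorial := by
    rw [add_right_comm m j K]
    simpa only [Nat.add_sub_cancel] using
      Nat.factorial_mul_descFactorial (Nat.le_add_left j (m + K))
  have h : m.factorial * (m + j).descFactorial j = (m + j).factorial := by
    simpa only [Nat.add_sub_cancel] using Nat.factorial_mul_descFactorial (Nat.le_add_left j m)
  refine Nat.eq_of_mul_eq_mul_right (Nat.mul_pos m.factorial_pos K.factorial_pos) ?_
  calc (m + K).choose K * (m + j + K).descFactorial j * (m.factorial * K.factorial)
      = ((m + K).choose K * m.factorial * K.factorial) * (m + j + K).descFactorial j := by ring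
    _ = (m + j + K).choose K * (m + j).factorial * K.factorial := by
      rw [Nat.add_choose_mul_factorial_mul_factorial, hK,
        Nat.add_choose_mul_factorial_mul_factorial]
    _ = _ := by rw [← h]; ring

/-- The quotient `C(n - j + K, K) / C(n + K, K)` of coefficients of `(1 - t)⁻ᴷ⁻¹`, which equals
`n (n - 1) ⋯ (n - j + 1) / ((n + K) ⋯ (n + K - j + 1))` and is `0` for `j > n`. -/
noncomputable def chooseRatio (n K j : ℕ) : ℝ :=
  n.descFactorial j / (n + K).descFactorial j

lemma choose_sub_eq_mul_chooseRatio {n j : ℕ} (K : ℕ) (hj : j ≤ n) :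
    ((n - j + K).choose K : ℝ) = (n + K).choose K * chooseRatio n K j := by
  obtain ⟨m, rfl⟩ := Nat.exists_eq_add_of_le' hj
  have hne : ((m + j + K).descFactorial j : ℝ) ≠ 0 :=
    Nat.cast_ne_zero.2 (Nat.descFactorial_pos.2 (by lia)).ne'
  rw [Nat.add_sub_cancel, chooseRatio, mul_div_assoc', eq_div_iff hne]
  exact_mod_cast choose_mul_descFactorial_add m j K

lemma chooseRatio_of_lt {n j : ℕ} (K : ℕ) (hj : n < j) : chooseRatio n K j = 0 := by
  rw [chooseRatio, Nat.descFactorial_of_lt hj, Nat.cast_zero, zero_div]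

lemma chooseRatio_succ (n K j : ℕ) : chooseRatio n K (j + 1)
    = ((n - j : ℕ) : ℝ) / ((n + K - j : ℕ) : ℝ) * chooseRatio n K j := by
  simp only [chooseRatio, Nat.descFactorial_succ, Nat.cast_mul, mul_div_mul_comm]

lemma chooseRatio_nonneg (n K j : ℕ) : 0 ≤ chooseRatio n K j := by
  unfold chooseRatio; positivity

lemma chooseRatio_le_one (n K j : ℕ) : chooseRatio n K j ≤ 1 :=
  div_le_one_of_le₀ (by exact_mod_cast Nat.descFactorial_le j (Nat.le_add_right n K))
    (by positivity)

lemma abs_natSub_div_sub_div_le (n j : ℕ) {K : ℕ} (hK : 0 < K) :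
    |((n - j : ℕ) : ℝ) / ((n + K - j : ℕ) : ℝ) - (n : ℝ) / (n + K)| ≤ j / K := by
  have : (0 : ℝ) < K := Nat.cast_pos.2 hK
  rcases le_or_gt j n with hjn | hnj
  · obtain ⟨m, rfl⟩ := Nat.exists_eq_add_of_le' hjn
    have hdiff : ((m + j - j : ℕ) : ℝ) / ((m + j + K - j : ℕ) : ℝ)
        - ((m + j : ℕ) : ℝ) / ((m + j : ℕ) + K) = -(j / (m + K) * (K / (m + j + K))) := by
      rw [Nat.add_sub_cancel, add_right_comm, Nat.add_sub_cancel]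
      push_cast
      field_simp
      ring
    rw [hdiff, abs_neg, abs_of_nonneg (by positivity)]
    calc (j : ℝ) / (m + K) * (K / (m + j + K)) ≤ j / K * 1 := by
          gcongr
          · exact le_add_of_nonneg_left m.cast_nonneg
          · exact div_le_one_of_le₀ (le_add_of_nonneg_left (by positivity)) (by positivity)
      _ = j / K := mul_one _
  · rw [Nat.sub_eq_zero_of_le hnj.le, Nat.cast_zero, zero_div, zero_sub, abs_neg,
      abs_of_nonneg (by positivity)]
    gcongr
    linarith [Nat.cast_nonneg (α := ℝ) n]

lemma abs_chooseRatio_sub_pow_le (n : ℕ) {K : ℕ} (hK : 0 < K) (j : ℕ) :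
    |chooseRatio n K j - ((n : ℝ) / (n + K)) ^ j| ≤ j ^ 2 / K := by
  induction j with
  | zero => simp [chooseRatio]
  | succ j ih =>
    have hfactor := abs_natSub_div_sub_div_le n j hK
    rw [chooseRatio_succ]
    set s : ℝ := (n : ℝ) / (n + K)
    set u : ℝ := ((n - j : ℕ) : ℝ) / ((n + K - j : ℕ) : ℝ)
    have hs0 : 0 ≤ s := by positivity
    have hs1 : s ≤ 1 := div_le_one_of_le₀ (le_add_of_nonneg_right K.cast_nonneg) (by positivity)
    calc |u * chooseRatio n K j - s ^ (j + 1)|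
        = |chooseRatio n K j * (u - s) + s * (chooseRatio n K j - s ^ j)| := by congr 1; ring
      _ ≤ chooseRatio n K j * |u - s| + s * |chooseRatio n K j - s ^ j| := by
        refine (abs_add_le _ _).trans_eq ?_
        rw [abs_mul, abs_mul, abs_of_nonneg (chooseRatio_nonneg n K j), abs_of_nonneg hs0]
      _ ≤ 1 * (j / K) + 1 * (j ^ 2 / K) := by
        gcongr
        exact chooseRatio_le_one n K j
      _ ≤ ((j + 1 : ℕ) : ℝ) ^ 2 / K := by
        rw [one_mul, one_mul, ← add_div]
        gcongr
        push_cast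
        nlinarith [Nat.cast_nonneg (α := ℝ) j]

lemma coeff_mul_invOneSubPow (p : ℝ[X]) (K n : ℕ) :
    coeff n ((p : ℝ⟦X⟧) * (PowerSeries.invOneSubPow ℝ (K + 1)).val)
      = (n + K).choose K * p.sum fun j c => c * chooseRatio n K j := by
  rw [PowerSeries.coeff_mul, Finset.Nat.sum_antidiagonal_eq_sum_range_succ_mk,
    PowerSeries.invOneSubPow_val_succ_eq_mk_add_choose, Polynomial.sum_def, Finset.mul_sum]
  refine Finset.sum_congr_of_eq_on_inter (fun j _ hj => ?_) (fun j _ hj => ?_) fun j hj _ => ?_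
  · simp [Polynomial.notMem_support_iff.1 hj]
  · rw [chooseRatio_of_lt K (by simpa using hj), mul_zero, mul_zero]
  · rw [Polynomial.coeff_coe, PowerSeries.coeff_mk, add_comm K,
      choose_sub_eq_mul_chooseRatio K (Finset.mem_range_succ_iff.1 hj)]
    ring

lemma exists_forall_mem_Icc_lt {f : ℝ → ℝ} {a b : ℝ} (hab : a ≤ b)
    (hf : ContinuousOn f (Set.Icc a b)) (hpos : ∀ t ∈ Set.Icc a b, 0 < f t) :
    ∃ δ, 0 < δ ∧ ∀ t ∈ Set.Icc a b, δ < f t := by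
  obtain ⟨t₀, ht₀, hmin⟩ := isCompact_Icc.exists_isMinOn (Set.nonempty_Icc.2 hab) hf
  exact ⟨f t₀ / 2, half_pos (hpos t₀ ht₀),
    fun t ht => (half_lt_self (hpos t₀ ht₀)).trans_le (hmin ht)⟩

theorem eventually_coeff_mul_invOneSubPow_nonneg {p : ℝ[X]}
    (hp : ∀ t ∈ Set.Icc (0 : ℝ) 1, 0 < p.eval t) :
    ∀ᶠ K in atTop, ∀ n,
      0 ≤ coeff n ((p : ℝ⟦X⟧) * (PowerSeries.invOneSubPow ℝ (K + 1)).val) := by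
  obtain ⟨δ, hδ, hpδ⟩ := exists_forall_mem_Icc_lt zero_le_one p.continuous.continuousOn hp
  have herr : Tendsto (fun K : ℕ => p.sum fun j c => |c| * (j ^ 2 / K)) atTop (𝓝 0) := by
    simpa [Polynomial.sum_def] using tendsto_finsetSum p.support fun j _ =>
      (tendsto_const_div_atTop_nhds_zero_nat ((j : ℝ) ^ 2)).const_mul |p.coeff j|
  filter_upwards [herr.eventually_lt_const hδ, eventually_gt_atTop 0] with K hKδ hK n
  rw [coeff_mul_invOneSubPow]
  refine mul_nonneg (Nat.cast_nonneg _) ?_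
  set s : ℝ := (n : ℝ) / (n + K)
  have hs : s ∈ Set.Icc (0 : ℝ) 1 :=
    ⟨by positivity, div_le_one_of_le₀ (le_add_of_nonneg_right K.cast_nonneg) (by positivity)⟩
  have hdiff : |(p.sum fun j c => c * chooseRatio n K j) - p.eval s|
      ≤ p.sum fun j c => |c| * (j ^ 2 / K) := by
    rw [Polynomial.eval_eq_sum]
    simp only [Polynomial.sum_def]
    rw [← Finset.sum_sub_distrib]
    refine (Finset.abs_sum_le_sum_abs _ _).trans (Finset.sum_le_sum fun j _ => ?_)
    rw [← mul_sub, abs_mul]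
    gcongr
    exact abs_chooseRatio_sub_pow_le n hK j
  linarith [(abs_le.1 hdiff).1, hpδ s hs]

lemma exists_one_lt_forall_comp_eval_pos {p : ℝ[X]}
    (hp : ∀ t ∈ Set.Icc (0 : ℝ) 1, 0 < p.eval t) :
    ∃ ρ, 1 < ρ ∧ ∀ t ∈ Set.Icc (0 : ℝ) 1, 0 < (p.comp (.C ρ * .X)).eval t := by
  have hev : ∀ᶠ ρ : ℝ in 𝓝 1, ∀ t ∈ Set.Icc (0 : ℝ) 1, 0 < p.eval (ρ * t) := by
    refine isCompact_Icc.eventually_forall_of_forall_eventually fun t ht => ?_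
    have hc : Continuous fun z : ℝ × ℝ => p.eval (z.1 * z.2) := by fun_prop
    exact hc.continuousAt.eventually_const_lt (by simpa using hp t ht)
  obtain ⟨ρ, hρ, hρ1⟩ :=
    ((hev.filter_mono nhdsWithin_le_nhds).and (self_mem_nhdsWithin (s := Set.Ioi 1))).exists
  exact ⟨ρ, hρ1, by simpa using hρ⟩

theorem exists_multiplier_coeff_nonneg {p : ℝ[X]} (hp : ∀ t ∈ Set.Icc (0 : ℝ) 1, 0 < p.eval t) :
    ∃ g : ℝ⟦X⟧, constantCoeff g = 1 ∧ (∀ n, 0 ≤ coeff n g) ∧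
      (∃ r : ℝ≥0, 1 < r ∧ Summable fun n => coeff n g * r ^ n) ∧
      ∀ n, 0 ≤ coeff n (g * (p : ℝ⟦X⟧)) := by
  obtain ⟨ρ, hρ, hpρ⟩ := exists_one_lt_forall_comp_eval_pos hp
  obtain ⟨K, hK⟩ := (eventually_coeff_mul_invOneSubPow_nonneg hpρ).exists
  have hρ0 : 0 < ρ := one_pos.trans hρ
  set g : ℝ⟦X⟧ := PowerSeries.rescale ρ⁻¹ (PowerSeries.invOneSubPow ℝ (K + 1)).val
  have hg : ∀ n, coeff n g = ρ⁻¹ ^ n * (n + K).choose K := fun n => by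
    rw [PowerSeries.coeff_rescale, PowerSeries.invOneSubPow_val_succ_eq_mk_add_choose,
      PowerSeries.coeff_mk, add_comm K]
  have hp_rescale :
      (p : ℝ⟦X⟧) = PowerSeries.rescale ρ⁻¹ ((p.comp (.C ρ * .X) : ℝ[X]) : ℝ⟦X⟧) := by
    ext n
    rw [PowerSeries.coeff_rescale, Polynomial.coeff_coe, Polynomial.coeff_coe,
      Polynomial.comp_C_mul_X_coeff, mul_left_comm, ← mul_pow, inv_mul_cancel₀ hρ0.ne', one_pow,
      mul_one]
  refine ⟨g, by simp [← PowerSeries.coeff_zero_eq_constantCoeff_apply, hg],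
    fun n => by rw [hg]; positivity, ?_, fun n => ?_⟩
  · refine ⟨Real.toNNReal √ρ, Real.one_lt_toNNReal.2 (Real.lt_sqrt_of_sq_lt (by simpa)), ?_⟩
    have hlt : ‖ρ⁻¹ * √ρ‖ < 1 := by
      rw [Real.norm_of_nonneg (by positivity), inv_mul_lt_one₀ hρ0, Real.sqrt_lt' hρ0]
      exact lt_self_pow₀ hρ one_lt_two
    refine (summable_choose_mul_geometric_of_norm_lt_one K hlt).congr fun n => ?_
    rw [hg, Real.coe_toNNReal _ (Real.sqrt_nonneg ρ), mul_pow]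
    ring
  · rw [mul_comm, hp_rescale, ← map_mul, PowerSeries.coeff_rescale]
    exact mul_nonneg (by positivity) (hK n)

end Multiplier
section HereditaryForm

variable {𝕜 E F : Type*} [NontriviallyNormedField 𝕜] [NormedAddCommGroup E] [NormedSpace 𝕜 E]
  [NormedAddCommGroup F] [NormedSpace 𝕜 F] {f g : ℝ⟦X⟧} {T : E →L[𝕜] E}

/-- The sums `∑ |fₙ| ‖Tⁿ x‖²` are bounded by a multiple of `‖x‖²`. For a Hilbert space operator
this is the strong convergence of `∑ |fₙ| T*ⁿ Tⁿ`, hence the condition `f ∈ 𝒜_{T,ℝ}`. -/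
def HereditaryBounded (f : ℝ⟦X⟧) (T : E →L[𝕜] E) : Prop :=
  ∃ C : ℝ≥0, ∀ (x : E) (s : Finset ℕ), ∑ n ∈ s, |coeff n f| * ‖(T ^ n) x‖ ^ 2 ≤ C * ‖x‖ ^ 2

/-- The quadratic form `∑ fₙ ‖Tⁿ x‖² = ⟪f(T*, T) x, x⟫`, which makes sense in any normed space. -/
noncomputable def hereditaryForm (f : ℝ⟦X⟧) (T : E →L[𝕜] E) (x : E) : ℝ :=
  ∑' n, coeff n f * ‖(T ^ n) x‖ ^ 2

lemma pow_add_apply (T : E →L[𝕜] E) (n m : ℕ) (x : E) :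
    (T ^ (n + m)) x = (T ^ m) ((T ^ n) x) := by
  rw [add_comm, pow_add, mul_apply_eq_comp]

lemma HereditaryBounded.summable_abs (hf : HereditaryBounded f T) (x : E) :
    Summable fun n => |coeff n f| * ‖(T ^ n) x‖ ^ 2 := by
  obtain ⟨C, hC⟩ := hf
  exact summable_of_sum_le (fun n => by positivity) (hC x)

lemma HereditaryBounded.summable (hf : HereditaryBounded f T) (x : E) :
    Summable fun n => coeff n f * ‖(T ^ n) x‖ ^ 2 :=
  .of_norm <| (hf.summable_abs x).congr fun n => by simp

lemma HereditaryBounded.exists_tsum_abs_le (hf : HereditaryBounded f T) :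
    ∃ C : ℝ≥0, ∀ x, ∑' n, |coeff n f| * ‖(T ^ n) x‖ ^ 2 ≤ C * ‖x‖ ^ 2 := by
  obtain ⟨C, hC⟩ := hf
  exact ⟨C, fun x => Real.tsum_le_of_sum_le (fun n => by positivity) (hC x)⟩

lemma HereditaryBounded.coeffAbs (hf : HereditaryBounded f T) :
    HereditaryBounded (.mk fun n => |coeff n f|) T := by
  simpa only [HereditaryBounded, PowerSeries.coeff_mk, abs_abs] using hf

lemma HereditaryBounded.of_summable (h : Summable fun n => |coeff n f| * ‖T ^ n‖ ^ 2) :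
    HereditaryBounded f T := by
  have hnonneg : 0 ≤ ∑' n, |coeff n f| * ‖T ^ n‖ ^ 2 := tsum_nonneg fun n => by positivity
  refine ⟨⟨_, hnonneg⟩, fun x s => ?_⟩
  calc ∑ n ∈ s, |coeff n f| * ‖(T ^ n) x‖ ^ 2
      ≤ ∑ n ∈ s, |coeff n f| * (‖T ^ n‖ * ‖x‖) ^ 2 := by
        gcongr
        exact (T ^ _).le_opNorm x
    _ = (∑ n ∈ s, |coeff n f| * ‖T ^ n‖ ^ 2) * ‖x‖ ^ 2 := by
        simp only [mul_pow, ← mul_assoc, Finset.sum_mul]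
    _ ≤ _ := by
        gcongr
        exact h.sum_le_tsum s fun n _ => by positivity

lemma HereditaryBounded.of_polynomial (p : ℝ[X]) (T : E →L[𝕜] E) :
    HereditaryBounded (p : ℝ⟦X⟧) T :=
  .of_summable <| summable_of_ne_finset_zero (s := p.support) fun n hn => by
    simp [Polynomial.notMem_support_iff.1 hn]

lemma HereditaryBounded.conj (hf : HereditaryBounded f T) (B : E ≃L[𝕜] F) :
    HereditaryBounded f (B.conjContinuousAlgEquiv T) := by
  obtain ⟨C, hC⟩ := hf
  refine ⟨‖(B : E →L[𝕜] F)‖₊ ^ 2 * (C * ‖(B.symm : F →L[𝕜] E)‖₊ ^ 2), fun y s => ?_⟩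
  calc ∑ n ∈ s, |coeff n f| * ‖(B.conjContinuousAlgEquiv T ^ n) y‖ ^ 2
      ≤ ∑ n ∈ s, |coeff n f| * (‖(B : E →L[𝕜] F)‖ * ‖(T ^ n) (B.symm y)‖) ^ 2 := by
        gcongr with n
        rw [← map_pow]
        exact (B : E →L[𝕜] F).le_opNorm _
    _ = ‖(B : E →L[𝕜] F)‖ ^ 2 * ∑ n ∈ s, |coeff n f| * ‖(T ^ n) (B.symm y)‖ ^ 2 := by
        rw [Finset.mul_sum]
        exact Finset.sum_congr rfl fun n _ => by ring
    _ ≤ ‖(B : E →L[𝕜] F)‖ ^ 2 * (C * (‖(B.symm : F →L[𝕜] E)‖ * ‖y‖) ^ 2) := by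
        grw [hC, ← (B.symm : F →L[𝕜] E).le_opNorm y]
        rfl
    _ = _ := by push_cast; ring

lemma hasSum_coeff_mul {u : ℕ → ℝ}
    (h : Summable fun p : ℕ × ℕ => coeff p.1 f * (coeff p.2 g * u (p.1 + p.2))) :
    HasSum (fun N => coeff N (f * g) * u N) (∑' n, coeff n f * ∑' m, coeff m g * u (n + m)) := by
  have hprod : HasSum (fun p : ℕ × ℕ => coeff p.1 f * (coeff p.2 g * u (p.1 + p.2)))
      (∑' n, coeff n f * ∑' m, coeff m g * u (n + m)) := by
    simpa only [h.tsum_prod, tsum_mul_left] using h.hasSum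
  convert ((Finset.HasAntidiagonal.sigmaAntidiagonalEquivProd (A := ℕ)).hasSum_iff.2 hprod).sigma
    fun N => hasSum_fintype _ using 2 with N
  rw [PowerSeries.coeff_mul, Finset.sum_mul, ← Finset.sum_coe_sort]
  refine Finset.sum_congr rfl fun p _ => ?_
  have hpN : (p : ℕ × ℕ).1 + (p : ℕ × ℕ).2 = N := Finset.HasAntidiagonal.mem_antidiagonal.1 p.2
  simp [hpN, mul_assoc]

lemma HereditaryBounded.summable_prod (hf : HereditaryBounded f T) (hg : HereditaryBounded g T)
    (x : E) :
    Summable fun p : ℕ × ℕ => coeff p.1 f * (coeff p.2 g * ‖(T ^ (p.1 + p.2)) x‖ ^ 2) := by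
  obtain ⟨C, hC⟩ := hg.exists_tsum_abs_le
  rw [← summable_abs_iff]
  simp only [abs_mul, abs_pow, abs_norm, pow_add_apply]
  refine (summable_prod_of_nonneg fun p => by positivity).2
    ⟨fun n => (hg.summable_abs ((T ^ n) x)).mul_left |coeff n f|, ?_⟩
  refine .of_nonneg_of_le (fun n => by positivity) (fun n => ?_)
    ((hf.summable_abs x).mul_left (C : ℝ))
  dsimp only
  rw [tsum_mul_left, mul_left_comm]
  gcongr
  exact hC _

lemma HereditaryBounded.hasSum_mul (hf : HereditaryBounded f T) (hg : HereditaryBounded g T)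
    (x : E) :
    HasSum (fun N => coeff N (f * g) * ‖(T ^ N) x‖ ^ 2)
      (∑' n, coeff n f * hereditaryForm g T ((T ^ n) x)) := by
  simpa only [hereditaryForm, pow_add_apply] using
    hasSum_coeff_mul (u := fun n => ‖(T ^ n) x‖ ^ 2) (hf.summable_prod hg x)

theorem hereditaryForm_mul (hf : HereditaryBounded f T) (hg : HereditaryBounded g T) (x : E) :
    hereditaryForm (f * g) T x = ∑' n, coeff n f * hereditaryForm g T ((T ^ n) x) :=
  (hf.hasSum_mul hg x).tsum_eq

lemma HereditaryBounded.summable_mul_hereditaryForm (hf : HereditaryBounded f T)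
    (hg : HereditaryBounded g T) (x : E) :
    Summable fun n => coeff n f * hereditaryForm g T ((T ^ n) x) := by
  simpa only [hereditaryForm, tsum_mul_left, pow_add_apply] using (hf.summable_prod hg x).prod

theorem HereditaryBounded.mul (hf : HereditaryBounded f T) (hg : HereditaryBounded g T) :
    HereditaryBounded (f * g) T := by
  obtain ⟨Cf, hCf⟩ := hf.exists_tsum_abs_le
  obtain ⟨Cg, hCg⟩ := hg.exists_tsum_abs_le
  refine ⟨Cg * Cf, fun x s => ?_⟩
  have habs := hf.coeffAbs.hasSum_mul hg.coeffAbs x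
  simp only [hereditaryForm, PowerSeries.coeff_mk] at habs
  calc ∑ N ∈ s, |coeff N (f * g)| * ‖(T ^ N) x‖ ^ 2
      ≤ ∑ N ∈ s, coeff N ((PowerSeries.mk fun n => |coeff n f|) *
          PowerSeries.mk fun n => |coeff n g|) * ‖(T ^ N) x‖ ^ 2 := by
        gcongr with N
        simp only [PowerSeries.coeff_mul, PowerSeries.coeff_mk, ← abs_mul]
        exact Finset.abs_sum_le_sum_abs _ _
    _ ≤ ∑' n, |coeff n f| * ∑' m, |coeff m g| * ‖(T ^ m) ((T ^ n) x)‖ ^ 2 :=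
        sum_le_hasSum s (fun N _ => by
          simp only [PowerSeries.coeff_mul, PowerSeries.coeff_mk]; positivity) habs
    _ ≤ ∑' n, Cg * (|coeff n f| * ‖(T ^ n) x‖ ^ 2) := by
        refine Summable.tsum_le_tsum (fun n => ?_) ?_ ((hf.summable_abs x).mul_left _)
        · grw [hCg, mul_left_comm]
        · simpa only [hereditaryForm, PowerSeries.coeff_mk] using
            hf.coeffAbs.summable_mul_hereditaryForm hg.coeffAbs x
    _ ≤ (Cg * Cf : ℝ≥0) * ‖x‖ ^ 2 := by
        rw [tsum_mul_left, NNReal.coe_mul, mul_assoc]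
        gcongr
        exact hCf x

lemma hereditaryForm_mul_mono {f₁ f₂ : ℝ⟦X⟧} (hg : HereditaryBounded g T)
    (hg0 : ∀ n, 0 ≤ coeff n g) (hf₁ : HereditaryBounded f₁ T) (hf₂ : HereditaryBounded f₂ T)
    (hle : ∀ x, hereditaryForm f₁ T x ≤ hereditaryForm f₂ T x) (x : E) :
    hereditaryForm (g * f₁) T x ≤ hereditaryForm (g * f₂) T x := by
  rw [hereditaryForm_mul hg hf₁, hereditaryForm_mul hg hf₂]
  exact Summable.tsum_le_tsum (fun n => mul_le_mul_of_nonneg_left (hle _) (hg0 n))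
    (hg.summable_mul_hereditaryForm hf₁ x) (hg.summable_mul_hereditaryForm hf₂ x)

lemma constantCoeff_mul_norm_sq_le_hereditaryForm (hf : HereditaryBounded f T)
    (hf0 : ∀ n, 0 ≤ coeff n f) (x : E) :
    constantCoeff f * ‖x‖ ^ 2 ≤ hereditaryForm f T x := by
  simpa [hereditaryForm] using
    (hf.summable x).le_tsum 0 fun n _ => mul_nonneg (hf0 n) (by positivity)

lemma hereditaryForm_conj {B : E ≃L[𝕜] F} (hf : HereditaryBounded f T)
    (hg : HereditaryBounded g T) (hB : ∀ x, ‖B x‖ ^ 2 = hereditaryForm g T x) (y : F) :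
    hereditaryForm f (B.conjContinuousAlgEquiv T) y = hereditaryForm (f * g) T (B.symm y) := by
  rw [hereditaryForm_mul hf hg, hereditaryForm]
  simp only [← map_pow, ← hB]
  rfl

lemma hereditaryForm_trunc_sub_C (f : ℝ⟦X⟧) (T : E →L[𝕜] E) (N : ℕ) (ε : ℝ) (x : E) :
    hereditaryForm ((f.trunc N - .C ε : ℝ[X]) : ℝ⟦X⟧) T x
      = ∑ n ∈ Finset.range N, coeff n f * ‖(T ^ n) x‖ ^ 2 - ε * ‖x‖ ^ 2 := by
  have hsum : ∑ n ∈ Finset.range N, (f.trunc N).coeff n * ‖(T ^ n) x‖ ^ 2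
      = ∑ n ∈ Finset.range N, coeff n f * ‖(T ^ n) x‖ ^ 2 :=
    Finset.sum_congr rfl fun n hn => by
      rw [PowerSeries.coeff_trunc, if_pos (Finset.mem_range.1 hn)]
  have htrunc : HasSum (fun n => (f.trunc N).coeff n * ‖(T ^ n) x‖ ^ 2)
      (∑ n ∈ Finset.range N, coeff n f * ‖(T ^ n) x‖ ^ 2) :=
    hsum ▸ hasSum_sum_of_ne_finset_zero fun n hn => by
      rw [PowerSeries.coeff_trunc, if_neg (mt Finset.mem_range.2 hn), zero_mul]
  have hC : HasSum (fun n => (Polynomial.C ε).coeff n * ‖(T ^ n) x‖ ^ 2) (ε * ‖x‖ ^ 2) := by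
    convert hasSum_single (f := fun n => (Polynomial.C ε).coeff n * ‖(T ^ n) x‖ ^ 2) 0
      fun n hn => by rw [Polynomial.coeff_C_of_ne_zero hn, zero_mul] using 1
    rw [Polynomial.coeff_C_zero, pow_zero, one_apply_eq_self]
  simpa only [hereditaryForm, Polynomial.coeff_coe, Polynomial.coeff_sub, sub_mul] using
    (htrunc.sub hC).tsum_eq

end HereditaryForm

section Coercivity

lemma eventually_norm_pow_le_of_spectralRadius_lt {A : Type*} [NormedRing A] [NormedAlgebra ℂ A]
    [CompleteSpace A] {a : A} {r : ℝ≥0} (h : spectralRadius ℂ a < r) :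
    ∀ᶠ n in atTop, ‖a ^ n‖ ≤ r ^ n := by
  have hlim := spectrum.pow_nnnorm_pow_one_div_tendsto_nhds_spectralRadius a
  filter_upwards [hlim.eventually_lt_const h, eventually_gt_atTop 0] with n hn hn0
  rw [one_div, ENNReal.rpow_inv_lt_iff (by exact_mod_cast hn0), ENNReal.rpow_natCast] at hn
  exact_mod_cast hn.le

variable {E : Type*} [NormedAddCommGroup E] [NormedSpace ℂ E] [CompleteSpace E] {f g : ℝ⟦X⟧}
  {T : E →L[ℂ] E}

lemma HereditaryBounded.of_summable_mul_pow {r : ℝ≥0} (hr : 1 < r)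
    (hg : Summable fun n => |coeff n g| * r ^ n) (hT : spectralRadius ℂ T ≤ 1) :
    HereditaryBounded g T := by
  have hlt : spectralRadius ℂ T < (NNReal.sqrt r : ℝ≥0) :=
    hT.trans_lt (by exact_mod_cast NNReal.sqrt_one ▸ NNReal.sqrt_lt_sqrt.2 hr)
  refine .of_summable (.of_norm_bounded_eventually_nat hg ?_)
  filter_upwards [eventually_norm_pow_le_of_spectralRadius_lt hlt] with n hn
  rw [Real.norm_of_nonneg (by positivity)]
  gcongr
  calc ‖T ^ n‖ ^ 2 ≤ ((NNReal.sqrt r : ℝ) ^ n) ^ 2 := by gcongr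
    _ = (r : ℝ) ^ n := by
      rw [← pow_mul, mul_comm, pow_mul]
      exact_mod_cast congrArg (· ^ n) (NNReal.sq_sqrt r)

theorem exists_coercive_multiplier {p : ℝ[X]} (hp : ∀ t ∈ Set.Icc (0 : ℝ) 1, 0 < p.eval t)
    (hf : HereditaryBounded f T) (hT : spectralRadius ℂ T ≤ 1)
    (hpf : ∀ x, hereditaryForm (p : ℝ⟦X⟧) T x ≤ hereditaryForm f T x) :
    ∃ g : ℝ⟦X⟧, (∀ n, 0 ≤ coeff n g) ∧ HereditaryBounded g T ∧
      ∃ κ : ℝ, 0 < κ ∧ ∀ x, κ * ‖x‖ ^ 2 ≤ hereditaryForm (g * f) T x := by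
  obtain ⟨g, hg_zero, hg_nonneg, ⟨r, hr, hgr⟩, hgp⟩ := exists_multiplier_coeff_nonneg hp
  have hg : HereditaryBounded g T :=
    .of_summable_mul_pow hr (hgr.congr fun n => by rw [abs_of_nonneg (hg_nonneg n)]) hT
  have hpT := HereditaryBounded.of_polynomial p T
  have hgp_zero : constantCoeff (g * (p : ℝ⟦X⟧)) = p.eval 0 := by
    rw [map_mul, hg_zero, one_mul, Polynomial.constantCoeff_coe,
      Polynomial.coeff_zero_eq_eval_zero]
  refine ⟨g, hg_nonneg, hg, p.eval 0, hp 0 ⟨le_rfl, zero_le_one⟩, fun x => ?_⟩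
  calc p.eval 0 * ‖x‖ ^ 2 ≤ hereditaryForm (g * (p : ℝ⟦X⟧)) T x := by
        rw [← hgp_zero]
        exact constantCoeff_mul_norm_sq_le_hereditaryForm (hg.mul hpT) hgp x
    _ ≤ hereditaryForm (g * f) T x := hereditaryForm_mul_mono hg hg_nonneg hpT hf hpf x

end Coercivity

lemma exists_pos_eventually_lt_eval_trunc {f : ℝ⟦X⟧}
    (hsum : Summable fun n => |coeff n f|)
    (hpos : ∀ t ∈ Set.Icc (0 : ℝ) 1, 0 < ∑' n, coeff n f * t ^ n) :
    ∃ δ : ℝ, 0 < δ ∧ ∀ᶠ N in atTop, ∀ t ∈ Set.Icc (0 : ℝ) 1, δ < (f.trunc N).eval t := by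
  have hbound : ∀ (n : ℕ), ∀ t ∈ Set.Icc (0 : ℝ) 1, ‖coeff n f * t ^ n‖ ≤ |coeff n f| := by
    intro n t ht
    rw [norm_mul, Real.norm_eq_abs, Real.norm_of_nonneg (pow_nonneg ht.1 n)]
    exact mul_le_of_le_one_right (abs_nonneg _) (pow_le_one₀ ht.1 ht.2)
  obtain ⟨δ, hδ, hlt⟩ := exists_forall_mem_Icc_lt zero_le_one
    (continuousOn_tsum (fun n => by fun_prop) hsum hbound) hpos
  refine ⟨δ / 2, half_pos hδ, ?_⟩
  filter_upwards [Metric.tendstoUniformlyOn_iff.1 (tendstoUniformlyOn_tsum_nat hsum hbound)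
    _ (half_pos hδ)] with N hN t ht
  rw [← Polynomial.eval₂_id, PowerSeries.eval₂_trunc_eq_sum_range]
  simp only [RingHom.id_apply]
  linarith [hlt t ht, (abs_lt.1 (hN t ht)).2]

section HilbertSpace

variable {H : Type*} [NormedAddCommGroup H] [InnerProductSpace ℂ H] [CompleteSpace H]
  {f : ℝ⟦X⟧} {T S : H →L[ℂ] H}

lemma inner_adjoint_pow_mul_pow_apply (T : H →L[ℂ] H) (n : ℕ) (x y : H) :
    inner ℂ ((ContinuousLinearMap.adjoint T ^ n * T ^ n) x) y
      = inner ℂ ((T ^ n) x) ((T ^ n) y) := by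
  rw [← ContinuousLinearMap.star_eq_adjoint, ← star_pow, ContinuousLinearMap.star_eq_adjoint,
    mul_apply_eq_comp, ContinuousLinearMap.adjoint_inner_left]

lemma inner_hereditaryPartialSum_self (c : ℕ → ℝ) (T : H →L[ℂ] H) (N : ℕ) (x : H) :
    inner ℂ (hereditaryPartialSum (fun n => (c n : ℂ)) T N x) x
      = ((∑ n ∈ Finset.range N, c n * ‖(T ^ n) x‖ ^ 2 : ℝ) : ℂ) := by
  rw [hereditaryPartialSum, sum_apply, sum_inner, Complex.ofReal_sum]
  refine Finset.sum_congr rfl fun n _ => ?_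
  rw [smul_apply, inner_smul_left, Complex.conj_ofReal, inner_adjoint_pow_mul_pow_apply,
    inner_self_eq_norm_sq_to_K]
  push_cast
  rfl

lemma ConvergesSOT.tendsto_sum {c : ℕ → ℝ} (hS : ConvergesSOT (fun n => (c n : ℂ)) T S) (x : H) :
    Tendsto (fun N => ((∑ n ∈ Finset.range N, c n * ‖(T ^ n) x‖ ^ 2 : ℝ) : ℂ)) atTop
      (𝓝 (inner ℂ (S x) x)) := by
  simp only [← inner_hereditaryPartialSum_self]
  exact (hS x).inner tendsto_const_nhds

lemma ConvergesSOT.hereditaryBounded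
    (hS : ConvergesSOT (fun n => ((|coeff n f| : ℝ) : ℂ)) T S) : HereditaryBounded f T := by
  refine ⟨‖S‖₊, fun x s => ?_⟩
  have hsum : HasSum (fun n => |coeff n f| * ‖(T ^ n) x‖ ^ 2) (inner ℂ (S x) x).re :=
    (hasSum_iff_tendsto_nat_of_nonneg (fun n => by positivity) _).2
      ((Complex.continuous_re.tendsto _).comp (hS.tendsto_sum x))
  calc ∑ n ∈ s, |coeff n f| * ‖(T ^ n) x‖ ^ 2 ≤ (inner ℂ (S x) x).re :=
        sum_le_hasSum s (fun n _ => by positivity) hsum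
    _ ≤ ‖S x‖ * ‖x‖ := re_inner_le_norm (𝕜 := ℂ) (S x) x
    _ ≤ ‖S‖ * ‖x‖ * ‖x‖ := by gcongr; exact S.le_opNorm x
    _ = ‖S‖₊ * ‖x‖ ^ 2 := by rw [coe_nnnorm]; ring

lemma HereditaryBounded.inner_apply_self (hf : HereditaryBounded f T)
    (hS : ConvergesSOT (fun n => ((coeff n f : ℝ) : ℂ)) T S) (x : H) :
    inner ℂ (S x) x = (hereditaryForm f T x : ℂ) :=
  tendsto_nhds_unique (hS.tendsto_sum x)
    ((Complex.continuous_ofReal.tendsto _).comp (hf.summable x).hasSum.tendsto_sum_nat)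

lemma HereditaryBounded.isPositive_iff (hf : HereditaryBounded f T)
    (hS : ConvergesSOT (fun n => ((coeff n f : ℝ) : ℂ)) T S) :
    S.IsPositive ↔ ∀ x, 0 ≤ hereditaryForm f T x := by
  simp [ContinuousLinearMap.isPositive_iff_complex, hf.inner_apply_self hS]

lemma norm_sum_smul_adjoint_pow_mul_pow_sq_le {C : ℝ≥0} {c : ℕ → ℝ}
    (hC : ∀ (x : H) (s : Finset ℕ), ∑ n ∈ s, |c n| * ‖(T ^ n) x‖ ^ 2 ≤ C * ‖x‖ ^ 2)
    (x : H) (s : Finset ℕ) :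
    ‖∑ n ∈ s, (c n : ℂ) • (ContinuousLinearMap.adjoint T ^ n * T ^ n) x‖ ^ 2
      ≤ C * ∑ n ∈ s, |c n| * ‖(T ^ n) x‖ ^ 2 := by
  set z := ∑ n ∈ s, (c n : ℂ) • (ContinuousLinearMap.adjoint T ^ n * T ^ n) x with hz
  have hzz : ‖z‖ ^ 2 ≤ ∑ n ∈ s, |c n| * (‖(T ^ n) x‖ * ‖(T ^ n) z‖) := by
    rw [← inner_self_eq_norm_sq (𝕜 := ℂ)]
    nth_rewrite 1 [hz]
    rw [sum_inner, map_sum]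
    refine Finset.sum_le_sum fun n _ => ?_
    rw [inner_smul_left, inner_adjoint_pow_mul_pow_apply]
    refine (RCLike.re_le_norm _).trans ?_
    rw [norm_mul, RCLike.norm_conj, Complex.norm_real, Real.norm_eq_abs]
    gcongr
    exact norm_inner_le_norm _ _
  have hcauchySchwarz : (‖z‖ ^ 2) ^ 2 ≤ (C * ∑ n ∈ s, |c n| * ‖(T ^ n) x‖ ^ 2) * ‖z‖ ^ 2 :=
    calc (‖z‖ ^ 2) ^ 2 ≤ (∑ n ∈ s, |c n| * (‖(T ^ n) x‖ * ‖(T ^ n) z‖)) ^ 2 := by gcongr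
      _ ≤ (∑ n ∈ s, |c n| * ‖(T ^ n) x‖ ^ 2) * ∑ n ∈ s, |c n| * ‖(T ^ n) z‖ ^ 2 :=
        Finset.sum_sq_le_sum_mul_sum_of_sq_le_mul s (fun n _ => by positivity)
          (fun n _ => by positivity) fun n _ => le_of_eq (by ring)
      _ ≤ (∑ n ∈ s, |c n| * ‖(T ^ n) x‖ ^ 2) * (C * ‖z‖ ^ 2) := by
        gcongr
        exact hC z s
      _ = _ := by ring
  rcases (sq_nonneg ‖z‖).eq_or_lt with hz0 | hz0
  · rw [← hz0]
    positivity
  · exact le_of_mul_le_mul_right (by rwa [← sq]) hz0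

theorem HereditaryBounded.exists_convergesSOT (hf : HereditaryBounded f T) :
    ∃ S, ConvergesSOT (fun n => ((coeff n f : ℝ) : ℂ)) T S := by
  obtain ⟨C, hC⟩ := id hf
  have hsummable : ∀ x : H, Summable fun n =>
      ((coeff n f : ℝ) : ℂ) • (ContinuousLinearMap.adjoint T ^ n * T ^ n) x := fun x => by
    refine summable_iff_vanishing_norm.2 fun ε hε => ?_
    obtain ⟨s, hs⟩ := summable_iff_vanishing_norm.1 (hf.summable_abs x) (ε ^ 2 / (C + 1))
      (by positivity)
    refine ⟨s, fun t hst => lt_of_pow_lt_pow_left₀ 2 hε.le ?_⟩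
    have htail := (Real.le_norm_self _).trans_lt (hs t hst)
    calc _ ≤ (C : ℝ) * ∑ n ∈ t, |coeff n f| * ‖(T ^ n) x‖ ^ 2 :=
          norm_sum_smul_adjoint_pow_mul_pow_sq_le hC x t
      _ ≤ C * (ε ^ 2 / (C + 1)) := by gcongr
      _ < (C + 1) * (ε ^ 2 / (C + 1)) := by gcongr; exact lt_add_one _
      _ = ε ^ 2 := by field_simp
  have hlim : Tendsto (fun N x => hereditaryPartialSum (fun n => ((coeff n f : ℝ) : ℂ)) T N x) atTop
      (𝓝 fun x => ∑' n, ((coeff n f : ℝ) : ℂ) • (ContinuousLinearMap.adjoint T ^ n * T ^ n) x) :=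
    tendsto_pi_nhds.2 fun x => by
      simpa only [hereditaryPartialSum, sum_apply, smul_apply] using
        (hsummable x).hasSum.tendsto_sum_nat
  exact ⟨continuousLinearMapOfTendsto _ hlim, tendsto_pi_nhds.1 hlim⟩

lemma ConvergesNorm.convergesSOT {c : ℕ → ℂ} (hS : ConvergesNorm c T S) : ConvergesSOT c T S :=
  fun x => ((ContinuousLinearMap.apply ℂ H x).continuous.tendsto S).comp hS

lemma ConvergesNorm.eventually_tsum_abs_le
    (hS : ConvergesNorm (fun n => ((|coeff n f| : ℝ) : ℂ)) T S) {ε : ℝ} (hε : 0 < ε) :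
    ∀ᶠ N in atTop, ∀ x, ∑' n, |coeff n f| * ‖(T ^ n) x‖ ^ 2
      ≤ ∑ n ∈ Finset.range N, |coeff n f| * ‖(T ^ n) x‖ ^ 2 + ε * ‖x‖ ^ 2 := by
  have hf : HereditaryBounded f T := hS.convergesSOT.hereditaryBounded
  filter_upwards [Metric.tendsto_nhds.1 hS ε hε] with N hN x
  set S_N := hereditaryPartialSum (fun n => ((|coeff n f| : ℝ) : ℂ)) T N
  have hSx : (inner ℂ (S x) x).re = ∑' n, |coeff n f| * ‖(T ^ n) x‖ ^ 2 :=
    tendsto_nhds_unique ((Complex.continuous_re.tendsto _).comp (hS.convergesSOT.tendsto_sum x))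
      (hf.summable_abs x).hasSum.tendsto_sum_nat
  have hSNx : (inner ℂ (S_N x) x).re = ∑ n ∈ Finset.range N, |coeff n f| * ‖(T ^ n) x‖ ^ 2 := by
    rw [inner_hereditaryPartialSum_self (fun n => |coeff n f|), Complex.ofReal_re]
  rw [← hSx, ← hSNx, ← sub_le_iff_le_add', ← Complex.sub_re, ← inner_sub_left, ← sub_apply]
  calc (inner ℂ ((S - S_N) x) x).re ≤ ‖(S - S_N) x‖ * ‖x‖ := re_inner_le_norm (𝕜 := ℂ) _ x
    _ ≤ ‖S - S_N‖ * ‖x‖ * ‖x‖ := by gcongr; exact (S - S_N).le_opNorm x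
    _ ≤ ε * ‖x‖ * ‖x‖ := by
      gcongr
      rw [← dist_eq_norm, dist_comm]
      exact hN.le
    _ = ε * ‖x‖ ^ 2 := by ring

lemma exists_polynomial_pos_hereditaryForm_le
    (hS : ConvergesNorm (fun n => ((|coeff n f| : ℝ) : ℂ)) T S)
    (hsum : Summable fun n => |coeff n f|)
    (hpos : ∀ t ∈ Set.Icc (0 : ℝ) 1, 0 < ∑' n, coeff n f * t ^ n) :
    ∃ p : ℝ[X], (∀ t ∈ Set.Icc (0 : ℝ) 1, 0 < p.eval t) ∧
      ∀ x, hereditaryForm (p : ℝ⟦X⟧) T x ≤ hereditaryForm f T x := by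
  have hf : HereditaryBounded f T := hS.convergesSOT.hereditaryBounded
  obtain ⟨ε, hε, hev⟩ := exists_pos_eventually_lt_eval_trunc hsum hpos
  obtain ⟨N, htrunc, htail⟩ := (hev.and (hS.eventually_tsum_abs_le hε)).exists
  refine ⟨f.trunc N - .C ε, fun t ht => by simpa using htrunc t ht, fun x => ?_⟩
  rw [hereditaryForm_trunc_sub_C, hereditaryForm]
  have hle := ((hf.summable x).add (hf.summable_abs x)).sum_le_tsum (Finset.range N) fun n _ => by
    rw [← add_mul]
    exact mul_nonneg (by linarith [neg_abs_le (coeff n f)]) (by positivity)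
  rw [(hf.summable x).tsum_add (hf.summable_abs x), Finset.sum_add_distrib] at hle
  linarith [htail x]

lemma exists_equiv_norm_sq_eq_inner {P : H →L[ℂ] H} (hP : P.IsPositive) {κ : ℝ} (hκ : 0 < κ)
    (hcoer : ∀ x, κ * ‖x‖ ^ 2 ≤ ‖inner ℂ (P x) x‖) :
    ∃ B : H ≃L[ℂ] H, ∀ x, ((‖B x‖ ^ 2 : ℝ) : ℂ) = inner ℂ (P x) x := by
  have hP0 : 0 ≤ P := P.nonneg_iff_isPositive.2 hP
  have hunit : IsUnit P := P.isUnit_of_forall_le_norm_inner_map (c := ⟨κ, hκ.le⟩) hκ fun x =>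
    (mul_comm _ _).trans_le (hcoer x)
  obtain ⟨U, hU⟩ := (CFC.isUnit_sqrt_iff P hP0).2 hunit
  refine ⟨ContinuousLinearEquiv.unitsEquiv ℂ H U, fun x => ?_⟩
  have hUx : ContinuousLinearEquiv.unitsEquiv ℂ H U x = CFC.sqrt P x := by rw [← hU]; rfl
  have hadjoint : ContinuousLinearMap.adjoint (CFC.sqrt P) = CFC.sqrt P :=
    (IsSelfAdjoint.of_nonneg (CFC.sqrt_nonneg P)).star_eq
  calc ((‖ContinuousLinearEquiv.unitsEquiv ℂ H U x‖ ^ 2 : ℝ) : ℂ)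
      = inner ℂ (CFC.sqrt P x) (CFC.sqrt P x) := by
        rw [hUx, inner_self_eq_norm_sq_to_K, Complex.ofReal_pow]
        rfl
    _ = inner ℂ (P x) x := by
        rw [← ContinuousLinearMap.adjoint_inner_left, hadjoint, ← mul_apply_eq_comp,
          CFC.sqrt_mul_sqrt_self P hP0]

theorem exists_equiv_norm_sq_eq_hereditaryForm (hf : HereditaryBounded f T) {κ : ℝ} (hκ : 0 < κ)
    (hcoer : ∀ x, κ * ‖x‖ ^ 2 ≤ hereditaryForm f T x) :
    ∃ B : H ≃L[ℂ] H, ∀ x, ‖B x‖ ^ 2 = hereditaryForm f T x := by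
  obtain ⟨P, hP⟩ := hf.exists_convergesSOT
  have hform : ∀ x, inner ℂ (P x) x = (hereditaryForm f T x : ℂ) := hf.inner_apply_self hP
  have hpos : P.IsPositive :=
    (hf.isPositive_iff hP).2 fun x => (mul_nonneg hκ.le (sq_nonneg _)).trans (hcoer x)
  obtain ⟨B, hB⟩ := exists_equiv_norm_sq_eq_inner hpos hκ fun x => by
    rw [hform, Complex.norm_real]
    exact (hcoer x).trans (Real.le_norm_self _)
  exact ⟨B, fun x => Complex.ofReal_injective ((hB x).trans (hform x))⟩

end HilbertSpace

section TaylorSeries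

variable {f f₁ f₂ : ℂ → ℂ} {F F₁ F₂ : ℝ⟦X⟧}

/-- `F` is the Taylor series of `f` at the origin, all of whose coefficients are real. It transfers
the assertions on functions with real Taylor coefficients to the algebra of power series. -/
def HasRealTaylorSeries (f : ℂ → ℂ) (F : ℝ⟦X⟧) : Prop :=
  ∀ n, taylorCoeff f n = ((coeff n F : ℝ) : ℂ)

lemma HasRealCoeffs.exists_hasRealTaylorSeries (hf : HasRealCoeffs f) :
    ∃ F, HasRealTaylorSeries f F :=
  ⟨.mk fun n => (taylorCoeff f n).re, fun n => by
    rw [PowerSeries.coeff_mk]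
    exact Complex.ext rfl (hf n)⟩

lemma HasRealTaylorSeries.norm_taylorCoeff (hF : HasRealTaylorSeries f F) (n : ℕ) :
    ‖taylorCoeff f n‖ = |coeff n F| := by
  rw [hF, Complex.norm_real, Real.norm_eq_abs]

lemma HasRealTaylorSeries.tsum_eq_re (hF : HasRealTaylorSeries f F) (hf : MemWiener f) {t : ℝ}
    (ht : t ∈ Set.Icc (0 : ℝ) 1) : ∑' n, coeff n F * t ^ n = (f t).re := by
  have hsum := hf.hasSum (t : ℂ) (by rw [Complex.norm_real, Real.norm_of_nonneg ht.1]; exact ht.2)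
  simp only [hF _, ← Complex.ofReal_pow, ← Complex.ofReal_mul] at hsum
  exact (Complex.hasSum_re hsum).tsum_eq

lemma HasRealTaylorSeries.congr (hF : HasRealTaylorSeries f₁ F) (h : f₁ =ᶠ[𝓝 0] f₂) :
    HasRealTaylorSeries f₂ F := fun n => by
  rw [← hF n, taylorCoeff, taylorCoeff, h.iteratedDeriv_eq]

lemma taylorCoeff_mul (hf₁ : AnalyticAt ℂ f₁ 0) (hf₂ : AnalyticAt ℂ f₂ 0) (n : ℕ) :
    taylorCoeff (f₁ * f₂) n
      = ∑ p ∈ Finset.HasAntidiagonal.antidiagonal n, taylorCoeff f₁ p.1 * taylorCoeff f₂ p.2 := by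
  unfold taylorCoeff
  rw [iteratedDeriv_mul hf₁.contDiffAt hf₂.contDiffAt,
    Finset.Nat.sum_antidiagonal_eq_sum_range_succ_mk, Finset.sum_div]
  refine Finset.sum_congr rfl fun i hi => ?_
  have hfactorial : ∀ m : ℕ, (m.factorial : ℂ) ≠ 0 := fun m => mod_cast m.factorial_ne_zero
  rw [Nat.cast_choose ℂ (Finset.mem_range_succ_iff.1 hi)]
  field_simp [hfactorial]

lemma HasRealTaylorSeries.mul (hF₁ : HasRealTaylorSeries f₁ F₁) (hF₂ : HasRealTaylorSeries f₂ F₂)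
    (hf₁ : AnalyticAt ℂ f₁ 0) (hf₂ : AnalyticAt ℂ f₂ 0) :
    HasRealTaylorSeries (f₁ * f₂) (F₁ * F₂) := fun n => by
  rw [taylorCoeff_mul hf₁ hf₂, PowerSeries.coeff_mul]
  simp only [hF₁ _, hF₂ _, Complex.ofReal_sum, Complex.ofReal_mul]

lemma MemWiener.analyticAt_zero (hf : MemWiener f) : AnalyticAt ℂ f 0 := by
  have hseries : DifferentiableOn ℂ (fun t : ℂ => ∑' n, taylorCoeff f n * t ^ n)
      (Metric.ball 0 1) := by
    refine Complex.differentiableOn_tsum_of_summable_norm hf.summable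
      (fun n => by fun_prop) Metric.isOpen_ball fun n t ht => ?_
    rw [norm_mul, norm_pow]
    exact mul_le_of_le_one_right (norm_nonneg _)
      (pow_le_one₀ (norm_nonneg _) (mem_ball_zero_iff.1 ht).le)
  have hdiff : DifferentiableOn ℂ f (Metric.ball 0 1) := hseries.congr fun t ht =>
    (hf.hasSum t (mem_ball_zero_iff.1 ht).le).tsum_eq.symm
  exact hdiff.analyticAt (Metric.ball_mem_nhds 0 one_pos)

variable {H : Type*} [NormedAddCommGroup H] [InnerProductSpace ℂ H] [CompleteSpace H]
  {T : H →L[ℂ] H}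

lemma HasRealTaylorSeries.hereditaryBounded (hF : HasRealTaylorSeries f F) (hf : MemA T f) :
    HereditaryBounded F T := by
  obtain ⟨-, S, hS⟩ := hf
  simp only [hF.norm_taylorCoeff] at hS
  exact hS.hereditaryBounded

lemma MemA0.memA (hf : MemA0 T f) : MemA T f :=
  ⟨hf.1, hf.2.imp fun _ hS => hS.convergesSOT⟩

lemma HasRealTaylorSeries.exists_polynomial_minorant (hF : HasRealTaylorSeries f F)
    (hf : MemA0 T f) (hpos : ∀ t ∈ Set.Icc (0 : ℝ) 1, 0 < (f (t : ℂ)).re) :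
    ∃ p : ℝ[X], (∀ t ∈ Set.Icc (0 : ℝ) 1, 0 < p.eval t) ∧
      ∀ x, hereditaryForm (p : ℝ⟦X⟧) T x ≤ hereditaryForm F T x := by
  obtain ⟨hfW, S, hS⟩ := hf
  simp only [hF.norm_taylorCoeff] at hS
  refine exists_polynomial_pos_hereditaryForm_le hS ?_ fun t ht => ?_
  · simpa only [hF.norm_taylorCoeff] using hfW.summable
  · exact (hF.tsum_eq_re hfW ht).symm ▸ hpos t ht

lemma HasRealTaylorSeries.hereditaryConverges (hF : HasRealTaylorSeries f F)
    (hb : HereditaryBounded F T) : HereditaryConverges f T := by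
  rw [HereditaryConverges, funext hF]
  exact hb.exists_convergesSOT

lemma HasRealTaylorSeries.isPositive_hereditary_iff (hF : HasRealTaylorSeries f F)
    (hb : HereditaryBounded F T) :
    (hereditary f T).IsPositive ↔ ∀ x, 0 ≤ hereditaryForm F T x := by
  have hconv : HereditaryConverges f T := hF.hereditaryConverges hb
  rw [hereditary, dif_pos hconv]
  exact hb.isPositive_iff (funext hF ▸ hconv.choose_spec)

end TaylorSeries

lemma spectralRadius_le_one {A : Type*} [Ring A] [Algebra ℂ A] {a : A}
    (ha : spectrum ℂ a ⊆ Metric.closedBall 0 1) : spectralRadius ℂ a ≤ 1 :=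
  iSup₂_le fun k hk => by exact_mod_cast mem_closedBall_zero_iff.1 (ha hk)

theorem corollary1p2_general {H : Type*} [NormedAddCommGroup H] [InnerProductSpace ℂ H]
    [CompleteSpace H] (That : H →L[ℂ] H)
    (hspec : spectrum ℂ That ⊆ Metric.closedBall (0 : ℂ) 1) (α γ γt : ℂ → ℂ)
    (hγ : ∀ t : ℂ, ‖t‖ < 1 → γ t = α t * γt t) (hα : MemAReal That α) (hγt : MemA0Real That γt)
    (hpos : ∀ t : ℝ, t ∈ Set.Icc (0 : ℝ) 1 → 0 < (γt (t : ℂ)).re)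
    (hnonneg : (hereditary γ That).IsPositive) :
    ∃ T : H →L[ℂ] H,
      IsSimilarOp That T ∧ HereditaryConverges α T ∧ (hereditary α T).IsPositive := by
  obtain ⟨A, hA⟩ := hα.2.exists_hasRealTaylorSeries
  obtain ⟨F, hF⟩ := hγt.2.exists_hasRealTaylorSeries
  have hAb : HereditaryBounded A That := hA.hereditaryBounded hα.1
  have hFb : HereditaryBounded F That := hF.hereditaryBounded hγt.1.memA
  have hAF : HasRealTaylorSeries γ (A * F) :=
    (hA.mul hF hα.1.1.analyticAt_zero hγt.1.1.analyticAt_zero).congr <| by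
      filter_upwards [Metric.ball_mem_nhds (0 : ℂ) one_pos] with t ht
      exact (hγ t (mem_ball_zero_iff.1 ht)).symm
  have hγform : ∀ x, 0 ≤ hereditaryForm (A * F) That x :=
    (hAF.isPositive_hereditary_iff (hAb.mul hFb)).1 hnonneg
  obtain ⟨p, hp, hpF⟩ := hF.exists_polynomial_minorant hγt.1 hpos
  obtain ⟨g, hg0, hgb, κ, hκ, hcoer⟩ :=
    exists_coercive_multiplier hp hFb (spectralRadius_le_one hspec) hpF
  obtain ⟨B, hB⟩ := exists_equiv_norm_sq_eq_hereditaryForm (hgb.mul hFb) hκ hcoer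
  refine ⟨B.conjContinuousAlgEquiv That, ⟨B, rfl⟩, hA.hereditaryConverges (hAb.conj B),
    (hA.isPositive_hereditary_iff (hAb.conj B)).2 fun y => ?_⟩
  rw [hereditaryForm_conj hAb (hgb.mul hFb) hB, mul_left_comm, hereditaryForm_mul hgb (hAb.mul hFb)]
  exact tsum_nonneg fun n => mul_nonneg (hg0 n) (hγform _)

theorem corollary1p2 {H : Type*} [NormedAddCommGroup H] [InnerProductSpace ℂ H]
    [CompleteSpace H] [TopologicalSpace.SeparableSpace H]
    (That : H →L[ℂ] H) (hspec : spectrum ℂ That ⊆ Metric.closedBall (0 : ℂ) 1)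
    (a : ℝ) (ha : 0 < a) (γ γt : ℂ → ℂ)
    (hγ : ∀ t : ℂ, ‖t‖ < 1 → γ t = oneSubPow a t * γt t)
    (hα : MemAReal That (oneSubPow a))
    (hγt : MemA0Real That γt)
    (hpos : ∀ t : ℝ, t ∈ Set.Icc (0 : ℝ) 1 → 0 < (γt (t : ℂ)).re)
    (hnonneg : (hereditary γ That).IsPositive) :
    ∃ T : H →L[ℂ] H, IsSimilarOp That T ∧ IsAContraction a T := by
  exact corollary1p2_general That hspec (oneSubPow a) γ γt hγ hα hγt hpos hnonneg
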